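/- Let $(A,\mathfrak m)$ be a Noetherian local ring (commutative, with identity) with infinite residue field, let $M$ be a finitely generated $A$-module, and let $I$ be an ideal of $A$. For a finitely generated module $N$ over a Noetherian ring and an ideal $J$ of that ring, $\operatorname{grade}(J,N)$ denotes the maximal length of an $N$-regular sequence contained in $J$ if $JN\neq N$, and $\operatorname{grade}(J,N)=\infty$ if $JN=N$. Let $\mathcal R(I)=\bigoplus_{n\ge 0}I^nt^n\subseteq A[t]$ be the Rees ring, with the ideal $R_+=\bigoplus_{n\ge 1}I^nt^n$. Let $G_I(A)=\bigoplus_{n\ge 0}I^n/I^{n+1}$ be the associated graded ring, with the ideal $G_+=\bigoplus_{n\ge 1}I^n/I^{n+1}$, and let $G_I(M)=\bigoplus_{n\ge 0}I^nM/I^{n+1}M$ be the associated graded $G_I(A)$-module. Let $L^I(M)=\bigoplus_{n\ge 0}M/I^{n+1}M$, regarded as an $\mathcal R(I)$-module in which $at^k$ (with $a\in I^k$) maps the class of $m$ in $M/I^{n+1}M$ to the class of $am$ in $M/I^{n+k+1}M$. Write $H^i_J(-)$ for local cohomology with support in an ideal $J$. Suppose that $\operatorname{grade}(I,M)=g$ with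 $0<g<\infty$. Then $H^i_{R_+}(L^I(M))\neq 0$ for some $0\le i\le g$, and $$\operatorname{grade}(G_+,G_I(M))=\min\{\,i : 0\le i\le g,\ H^i_{R_+}(L^I(M))\neq 0\,\}.$$ Moreover, for every integer $s$ with $0\le s\le g-1$, one has $H^i_{R_+}(L^I(M))=0$ for all $0\le i\le s$ if and only if $H^i_{G_+}(G_I(M))=0$ for all $0\le i\le s$. -/

import Mathlib

universe u

namespace AsymptoticGrade

open Polynomial

noncomputable section

section Grade

open scoped Classical in
/-- The grade of an ideal `J` on an `R`-module `N` (meant for `R` Noetherian, `N` finitely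
generated): the maximal length of an `N`-regular sequence contained in `J` if `J N ≠ N`, and `∞`
if `J N = N`. -/
def grade {R : Type*} [CommRing R] (J : Ideal R) (N : Type*) [AddCommGroup N] [Module R N] : ℕ∞ :=
  if J • (⊤ : Submodule R N) = ⊤ then ⊤
  else ⨆ (rs : List R) (_ : (∀ r ∈ rs, r ∈ J) ∧ RingTheory.Sequence.IsRegular N rs),
    (rs.length : ℕ∞)

end Grade

section LocalCohomology

/-- The `i`-th local cohomology module of the `R`-module `N` with support in the ideal `J`. -/
abbrev lc {R : Type u} [CommRing R] (J : Ideal R) (i : ℕ) (N : Type u)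
    [AddCommGroup N] [Module R N] : ModuleCat.{u} R :=
  (localCohomology J i).obj (ModuleCat.of R N)

end LocalCohomology

section Graded

variable {A : Type u} [CommRing A] (I : Ideal A)

/-- The ideal `R₊ = ⨁_{n ≥ 1} Iⁿ tⁿ` of the Rees ring `R(I) = ⨁_{n ≥ 0} Iⁿ tⁿ ⊆ A[t]`
(Mathlib's `reesAlgebra I`): the elements whose coefficient in degree `0` vanishes. -/
def reesPlus : Ideal (reesAlgebra I) :=
  RingHom.ker ((constantCoeff (R := A)).comp (reesAlgebra I).val.toRingHom)

/-- The ideal `⨁_{n ≥ 0} Iⁿ⁺¹ tⁿ` of the Rees ring `R(I)`. -/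
def reesShift : Ideal (reesAlgebra I) where
  carrier := {f | ∀ n, (f : A[X]).coeff n ∈ I ^ (n + 1)}
  add_mem' hf hg n := by
    simpa using Ideal.add_mem _ (hf n) (hg n)
  zero_mem' n := by simp
  smul_mem' r f hf n := by
    change ((r : A[X]) * (f : A[X])).coeff n ∈ _
    rw [coeff_mul]
    refine Ideal.sum_mem _ ?_
    rintro ⟨j, k⟩ e
    rw [Finset.HasAntidiagonal.mem_antidiagonal] at e
    rw [← e, add_assoc, pow_add]
    exact Ideal.mul_mem_mul (r.2 j) (hf k)

/-- The associated graded ring `G_I(A) = ⨁_{n ≥ 0} Iⁿ / Iⁿ⁺¹`, as the quotient of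
`⨁_{n ≥ 0} Iⁿ tⁿ` by `⨁_{n ≥ 0} Iⁿ⁺¹ tⁿ`. The class of `a tⁿ` with `a ∈ Iⁿ` is the class of `a`
in `Iⁿ / Iⁿ⁺¹`. -/
abbrev AssocGradedRing : Type u := reesAlgebra I ⧸ reesShift I

/-- The ideal `G₊ = ⨁_{n ≥ 1} Iⁿ / Iⁿ⁺¹` of `G_I(A)`, the image of `R₊`. -/
def assocGradedPlus : Ideal (AssocGradedRing I) :=
  (reesPlus I).map (Ideal.Quotient.mk (reesShift I))

variable (M : Type u) [AddCommGroup M] [Module A M]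

/-- The `R(I)`-submodule `⨁_{n ≥ 0} Iⁿ⁺ᵏ M tⁿ` of `M[t] = ⨁_{n ≥ 0} M tⁿ`. -/
def reesModuleShift (k : ℕ) : Submodule (reesAlgebra I) (PolynomialModule A M) where
  carrier := {f | ∀ n, f.coeff n ∈ I ^ (n + k) • (⊤ : Submodule A M)}
  add_mem' hf hg n := Submodule.add_mem _ (hf n) (hg n)
  zero_mem' _ := Submodule.zero_mem _
  smul_mem' r f hf n := by
    rw [Subalgebra.smul_def, PolynomialModule.smul_apply]
    refine Submodule.sum_mem _ ?_
    rintro ⟨i, j⟩ e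
    rw [Finset.HasAntidiagonal.mem_antidiagonal] at e
    rw [← e, add_assoc, pow_add, Submodule.mul_smul]
    exact Submodule.smul_mem_smul (r.2 i) (hf j)

/-- `L^I(M) = ⨁_{n ≥ 0} M / Iⁿ⁺¹ M` as a module over the Rees ring `R(I)`: the quotient of
`M[t] = ⨁_{n ≥ 0} M tⁿ` by `⨁_{n ≥ 0} Iⁿ⁺¹ M tⁿ`. For `a ∈ Iᵏ`, the element `a tᵏ` of `R(I)` sends
the class of `m` in `M / Iⁿ⁺¹ M` to the class of `a m` in `M / Iⁿ⁺ᵏ⁺¹ M`. -/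
abbrev LModule : Type u := PolynomialModule A M ⧸ reesModuleShift I M 1

/-- The associated graded module `G_I(M) = ⨁_{n ≥ 0} Iⁿ M / Iⁿ⁺¹ M`, as the image in
`L^I(M) = ⨁_{n ≥ 0} M / Iⁿ⁺¹ M` of the Rees module `R(I, M) = ⨁_{n ≥ 0} Iⁿ M tⁿ ⊆ M[t]`. -/
abbrev AssocGradedModule : Type u :=
  (reesModuleShift I M 0).map (reesModuleShift I M 1).mkQ

theorem assocGradedModule_isTorsionBySet :
    Module.IsTorsionBySet (reesAlgebra I) (AssocGradedModule I M)
      (reesShift I : Set (reesAlgebra I)) := by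
  rintro ⟨_, f, hf, rfl⟩ ⟨r, hr⟩
  refine Subtype.ext ?_
  change r • (reesModuleShift I M 1).mkQ f = 0
  rw [← map_smul, Submodule.mkQ_apply, Submodule.Quotient.mk_eq_zero]
  intro n
  rw [Subalgebra.smul_def, PolynomialModule.smul_apply]
  refine Submodule.sum_mem _ ?_
  rintro ⟨i, j⟩ e
  rw [Finset.HasAntidiagonal.mem_antidiagonal] at e
  rw [← e, show i + j + 1 = (i + 1) + (j + 0) by omega, pow_add, Submodule.mul_smul]
  exact Submodule.smul_mem_smul (hr i) (hf j)

/-- `G_I(M)` is a module over `G_I(A)`: the class of `r` in `G_I(A)` acts as `r` in `R(I)`. -/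
instance assocGradedModuleInst : Module (AssocGradedRing I) (AssocGradedModule I M) :=
  (assocGradedModule_isTorsionBySet I M).module

/-- `H^i_{R₊}(L^I(M))`, computed over the Rees ring `R(I)`. -/
abbrev lcL (i : ℕ) : ModuleCat.{u} (reesAlgebra I) :=
  lc (reesPlus I) i (LModule I M)

/-- `H^i_{G₊}(G_I(M))`, computed over the associated graded ring `G_I(A)`. -/
abbrev lcG (i : ℕ) : ModuleCat.{u} (AssocGradedRing I) :=
  lc (R := AssocGradedRing I) (assocGradedPlus I) i (AssocGradedModule I M)

end Graded

end

end AsymptoticGrade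

/-!
The theorem holds because the ranges of vanishing of the local cohomology of `L^I(M)` over the Rees
ring and of `G_I(M)` over the associated graded ring can be shortened simultaneously.

Let `x ∈ I` be such that its initial form in `I / I²` is a nonzerodivisor on `G_I(M)`
(`InitialRegular`). Then `(Iⁿ⁺¹ M : x) = Iⁿ M` for all `n`, so `x t` is regular on `L^I(M)` with
quotient `L^I(M / x M)`, and the initial form of `x` is regular on `G_I(M)` with quotient
`G_I(M / x M)`. By the long exact sequence (`lcVanish_succ_iff`), replacing `M` by `M / x M` lowers
by one the number of initial vanishing local cohomology modules of `L^I(M)` and of `G_I(M)`. Such an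
`x` exists as soon as `H⁰` of `L^I(M)` or of `G_I(M)` vanishes: no nonzero element of `G_I(M)` is
then killed by `R₊`, so no associated prime of `G_I(M)` contains all the `x t`, and as the residue
field is infinite some `x t` avoids all of them (`exists_initialRegular`). Induction gives that both
ranges of vanishing agree (`lcVanish_LModule_iff`), in all degrees. The elements `x` found in this
way form an `M`-regular sequence, by Krull's intersection theorem, so the common range has length at
most `grade(I, M) = g` (`exists_isRegular_of_lcVanish`), while for the finitely generated module
`G_I(M)` the length of the range is the grade of `G₊` (`lcVanish_iff_exists_isRegular`).

Local cohomology is the direct limit of the derived functors `Ext^i(R ⧸ Jⁿ, N)`, which are built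
from projective resolutions, whereas long exact sequences are available for `Abelian.Ext`. Only
vanishing matters here: `subsingleton_lc_iff` says that `H^i_J(N) = 0` if and only if each class of
`Abelian.Ext` of degree `i` on some `R ⧸ Jⁿ` dies on some `R ⧸ Jᵐ`, and this condition is
manipulated by exact sequences directly.
-/

namespace AsymptoticGrade

/-! ### Vanishing of local cohomology in terms of `Abelian.Ext` -/

section LocalCohomologyAsLimit
open CategoryTheory Opposite Limits

variable {R : Type u} [CommRing R]

/-- The map of cochain complexes `Hom(P, Y) ⟶ Hom(P', Y)` given by precomposition with
`φ : P' ⟶ P`. -/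
noncomputable def yonedaMap {P P' : ChainComplex (ModuleCat.{u} R) ℕ} (φ : P' ⟶ P)
    (Y : ModuleCat.{u} R) :
    P.linearYonedaObj R Y ⟶ P'.linearYonedaObj R Y :=
  (HomologicalComplex.unopFunctor (ModuleCat.{u} R) (ComplexShape.down ℕ)).map
    (((((linearYoneda R (ModuleCat.{u} R)).obj Y).rightOp.mapHomologicalComplex _).map φ).op)

/-- The computation of the derived functor `Ext` by projective resolutions is natural in the
first argument. -/
theorem isoExt_naturality {X X' : ModuleCat.{u} R} (g : X' ⟶ X) (P : ProjectiveResolution X)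
    (P' : ProjectiveResolution X') (φ : ProjectiveResolution.Hom P' P g) (n : ℕ)
    (Y : ModuleCat.{u} R) :
    ((Ext R (ModuleCat.{u} R) n).map g.op).app Y ≫ (P'.isoExt (R := R) n Y).hom =
      (P.isoExt (R := R) n Y).hom ≫ HomologicalComplex.homologyMap (yonedaMap φ.hom Y) n := by
  have h := P'.isoLeftDerivedObj_inv_naturality g P φ.hom
    (by simpa using φ.hom_f_zero_comp_π_f_zero)
    ((linearYoneda R (ModuleCat.{u} R)).obj Y).rightOp n
  have h3 := HomologicalComplex.homologyOp_hom_naturality (yonedaMap φ.hom Y) n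
  -- The composites below are only definitionally composable, so the two squares are pasted by
  -- general lemmas instead of by rewriting.
  have aux {C : Type (u+1)} [Category.{u} C] {a b c d e f : C} {f₁ : a ⟶ b} {f₂ : b ⟶ c}
      {f₃ : c ⟶ d} {g₁ : a ⟶ e} {g₂ : e ⟶ f} {g₃ : f ⟶ d} {k : e ⟶ c} (h₁ : f₁ ≫ f₂ = g₁ ≫ k)
      (h₂ : k ≫ f₃ = g₂ ≫ g₃) : f₁ ≫ f₂ ≫ f₃ = (g₁ ≫ g₂) ≫ g₃ := by
    rw [← Category.assoc, h₁, Category.assoc, h₂, Category.assoc]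
  have aux' {C : Type (u+1)} [Category.{u} C] {a b c d : C} {m : a ⟶ b} {k : b ≅ c} {l : a ≅ d}
      {n : d ⟶ c} (h : m ≫ k.hom = l.hom ≫ n) : l.inv ≫ m = n ≫ k.inv := by
    rw [Iso.inv_comp_eq, ← Category.assoc, Iso.eq_comp_inv, h]
  exact aux (congrArg Quiver.Hom.unop h) (congrArg Quiver.Hom.unop (aux' h3))

/-- The cochain `x` is a cocycle of `K` in degree `n` with cohomology class `h`. -/
def IsRep (K : CochainComplex (ModuleCat.{u} R) ℕ) (n : ℕ) (x : K.X n) (h : K.homology n) : Prop :=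
  ∃ z : K.cycles n, K.iCycles n z = x ∧ K.homologyπ n z = h

variable {K : CochainComplex (ModuleCat.{u} R) ℕ}

theorem exists_isRep {n : ℕ} (h : K.homology n) : ∃ x, K.d n (n + 1) x = 0 ∧ IsRep K n x h := by
  obtain ⟨z, rfl⟩ := (ModuleCat.epi_iff_surjective (K.homologyπ n)).1 inferInstance h
  refine ⟨K.iCycles n z, ?_, z, rfl, rfl⟩
  rw [← ConcreteCategory.comp_apply, K.iCycles_d]
  rfl

theorem exists_isRep_of_d_eq_zero {n : ℕ} (x : K.X n) (hx : K.d n (n + 1) x = 0) :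
    ∃ h, IsRep K n x h := by
  have hg : (K.sc n).g x = 0 := by
    have : (ComplexShape.up ℕ).next n = n + 1 := CochainComplex.next ℕ n
    change K.d n _ x = 0
    rw [this]
    exact hx
  refine ⟨_, (K.sc n).moduleCatCyclesIso.inv ⟨x, hg⟩, ?_, rfl⟩
  exact congr($((K.sc n).moduleCatCyclesIso_inv_iCycles) ⟨x, hg⟩)

theorem IsRep.eq_zero_iff {n : ℕ} {x : K.X n} {h : K.homology n} (hx : IsRep K n x h) :
    h = 0 ↔ ∃ m, ∃ y, K.d m n y = x := by
  obtain ⟨z, rfl, rfl⟩ := hx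
  have e : (K.sc n).moduleCatHomologyIso.hom ((K.sc n).homologyπ z) = 0 ↔
      (K.sc n).moduleCatCyclesIso.hom z ∈ LinearMap.range (K.sc n).moduleCatToCycles := by
    have h' : (K.sc n).moduleCatHomologyIso.hom ((K.sc n).homologyπ z) =
        (K.sc n).moduleCatLeftHomologyData.π ((K.sc n).moduleCatCyclesIso.hom z) :=
      congr($((K.sc n).π_moduleCatCyclesIso_hom) z)
    rw [h']
    exact Submodule.Quotient.mk_eq_zero _
  have e' : (K.sc n).moduleCatHomologyIso.hom ((K.sc n).homologyπ z) = 0 ↔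
      (K.sc n).homologyπ z = 0 :=
    map_eq_zero_iff _ ((ModuleCat.mono_iff_injective _).1 inferInstance)
  have hi : ((K.sc n).moduleCatCyclesIso.hom z).1 = K.iCycles n z :=
    congr($((K.sc n).moduleCatCyclesIso_hom_i) z)
  refine (e'.symm.trans e).trans ⟨fun ⟨y, hy⟩ => ⟨_, y, ?_⟩, fun ⟨m, y, hy⟩ => ?_⟩
  · exact (congrArg Subtype.val hy).trans hi
  · by_cases hm : (ComplexShape.up ℕ).Rel m n
    · obtain rfl := (ComplexShape.up ℕ).prev_eq' hm
      exact ⟨y, Subtype.ext (hy.trans hi.symm)⟩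
    · rw [K.shape _ _ hm] at hy
      exact ⟨0, Subtype.ext ((map_zero _).trans (hy.trans hi.symm))⟩

theorem IsRep.map {K' : CochainComplex (ModuleCat.{u} R) ℕ} (ψ : K ⟶ K') {n : ℕ} {x : K.X n}
    {h : K.homology n} (hx : IsRep K n x h) :
    IsRep K' n (ψ.f n x) (HomologicalComplex.homologyMap ψ n h) := by
  obtain ⟨z, rfl, rfl⟩ := hx
  refine ⟨HomologicalComplex.cyclesMap ψ n z, ?_, ?_⟩
  · exact congr($(HomologicalComplex.cyclesMap_i ψ n) z)
  · exact congr($(HomologicalComplex.homologyπ_naturality ψ n) z).symm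

open Abelian in
/-- Unlike `ProjectiveResolution.extMk_eq_zero_iff`, this covers degree `0`: then `P.complex.d 0 m`
is zero for all `m`, and the right-hand side says `f = 0`. -/
theorem extMk_eq_zero_iff_exists {X Y : ModuleCat.{u} R} (P : ProjectiveResolution X) {n : ℕ}
    (f : P.complex.X n ⟶ Y) (hf : P.complex.d (n + 1) n ≫ f = 0) :
    P.extMk f (n + 1) rfl hf = 0 ↔ ∃ m, ∃ g : P.complex.X m ⟶ Y, P.complex.d n m ≫ g = f := by
  cases n with
  | succ p =>
    rw [P.extMk_eq_zero_iff f _ rfl hf p rfl]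
    refine ⟨fun h => ⟨p, h⟩, fun ⟨m, g, hg⟩ => ?_⟩
    by_cases hm : m = p
    · subst hm
      exact ⟨g, hg⟩
    · rw [P.complex.shape _ _ (by simpa using hm)] at hg
      exact ⟨0, by simpa using hg⟩
  | zero =>
    have key : P.extMk f 1 rfl hf = 0 ↔ f = 0 := by
      refine ⟨fun h => ?_, by rintro rfl; simp⟩
      rw [← P.extEquivCohomologyClass.apply_eq_iff_eq, P.extEquivCohomologyClass_extMk,
        P.extEquivCohomologyClass_zero,
        CochainComplex.HomComplex.CohomologyClass.mk_eq_zero_iff,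
        CochainComplex.HomComplex.Cocycle.toSingleMk_mem_coboundaries_iff _ _ _ _ _ 1
          (by simp)] at h
      obtain ⟨g, hg⟩ := h
      have h0 : IsZero (P.cochainComplex.X 1) :=
        CochainComplex.isZero_of_isStrictlyLE _ 0 _
      rw [h0.eq_of_src g 0, comp_zero] at hg
      rw [← cancel_epi (P.cochainComplexXIso (-(0 : ℕ)) 0 rfl).hom, comp_zero]
      exact hg.symm
    rw [key]
    refine ⟨fun h => ⟨0, 0, by simp [h]⟩, fun ⟨m, g, hg⟩ => ?_⟩
    rw [P.complex.shape _ _ (by simp)] at hg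
    simpa using hg.symm

/-- Each class of the derived functor `Ext` at `X` is killed by some `g j : X' j ⟶ X` if and only if
the same holds for the classes of `Abelian.Ext`: both sides say that each cocycle on a projective
resolution of `X` becomes a coboundary on a resolution of some `X' j`. -/
theorem extFunctor_eventually_zero_iff {ι : Type*} {X : ModuleCat.{u} R} {X' : ι → ModuleCat.{u} R}
    (g : ∀ j, X' j ⟶ X) (Y : ModuleCat.{u} R) (n : ℕ) :
    (∀ e : ((Ext R (ModuleCat.{u} R) n).obj (op X)).obj Y, ∃ j,
      ((Ext R (ModuleCat.{u} R) n).map (g j).op).app Y e = 0) ↔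
    ∀ α : Abelian.Ext X Y n, ∃ j, (Abelian.Ext.mk₀ (g j)).comp α (zero_add n) = 0 := by
  let P := projectiveResolution X
  let P' j := projectiveResolution (X' j)
  let φ j : ProjectiveResolution.Hom (P' j) P (g j) :=
    { hom := ProjectiveResolution.lift (g j) (P' j) P
      hom_f_zero_comp_π_f_zero := by
        simpa using! ProjectiveResolution.lift_commutes_zero (g j) (P' j) P }
  trans ∀ f : P.complex.X n ⟶ Y, P.complex.d (n + 1) n ≫ f = 0 →
    ∃ j, ∃ m, ∃ y : (P' j).complex.X m ⟶ Y, (P' j).complex.d n m ≫ y = (φ j).hom.f n ≫ f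
  · have key (f : P.complex.X n ⟶ Y) (e : ((Ext R (ModuleCat.{u} R) n).obj (op X)).obj Y)
        (he : IsRep (P.complex.linearYonedaObj R Y) n f ((P.isoExt (R := R) n Y).hom e)) (j : ι) :
        ((Ext R (ModuleCat.{u} R) n).map (g j).op).app Y e = 0 ↔
        ∃ m, ∃ y : (P' j).complex.X m ⟶ Y, (P' j).complex.d n m ≫ y = (φ j).hom.f n ≫ f := by
      have h1 := (he.map (yonedaMap (φ j).hom Y)).eq_zero_iff
      have h2 : ((P' j).isoExt (R := R) n Y).hom
          (((Ext R (ModuleCat.{u} R) n).map (g j).op).app Y e) =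
          HomologicalComplex.homologyMap (yonedaMap (φ j).hom Y) n
            ((P.isoExt (R := R) n Y).hom e) :=
        congr($(isoExt_naturality (g j) P (P' j) (φ j) n Y) e)
      rw [← h2] at h1
      rw [map_eq_zero_iff _ ((ModuleCat.mono_iff_injective _).1 inferInstance)] at h1
      exact h1
    constructor
    · intro H f hf
      obtain ⟨h, hh⟩ := exists_isRep_of_d_eq_zero (K := P.complex.linearYonedaObj R Y) f hf
      obtain ⟨e, rfl⟩ :=
        (ModuleCat.epi_iff_surjective (P.isoExt (R := R) n Y).hom).1 inferInstance h
      obtain ⟨j, hj⟩ := H e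
      exact ⟨j, (key f e hh j).1 hj⟩
    · intro H e
      obtain ⟨f, hf, hfe⟩ := exists_isRep ((P.isoExt (R := R) n Y).hom e)
      obtain ⟨j, hj⟩ := H f hf
      exact ⟨j, (key f e hfe j).2 hj⟩
  · have key (f : P.complex.X n ⟶ Y) (hf : P.complex.d (n + 1) n ≫ f = 0) (j : ι) :
        (Abelian.Ext.mk₀ (g j)).comp (P.extMk f (n + 1) rfl hf) (zero_add n) = 0 ↔
        ∃ m, ∃ y : (P' j).complex.X m ⟶ Y, (P' j).complex.d n m ≫ y = (φ j).hom.f n ≫ f := by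
      rw [ProjectiveResolution.mk₀_comp_extMk f (n + 1) rfl hf (φ j), extMk_eq_zero_iff_exists]
    constructor
    · intro H α
      obtain ⟨f, hf, rfl⟩ := P.extMk_surjective α (n + 1) rfl
      obtain ⟨j, hj⟩ := H f hf
      exact ⟨j, (key f hf j).2 hj⟩
    · intro H f hf
      obtain ⟨j, hj⟩ := H (P.extMk f (n + 1) rfl hf)
      exact ⟨j, (key f hf j).1 hj⟩

/-- The projection `R ⧸ J ^ m ⟶ R ⧸ J ^ n` for `n ≤ m`. -/
def powProj (J : Ideal R) {n m : ℕ} (h : n ≤ m) :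
    ModuleCat.of R (R ⧸ J ^ m) ⟶ ModuleCat.of R (R ⧸ J ^ n) :=
  ModuleCat.ofHom (Submodule.mapQ _ _ LinearMap.id (Ideal.pow_le_pow_right h))

theorem powProj_comp (J : Ideal R) {n m l : ℕ} (h : n ≤ m) (h' : m ≤ l) :
    powProj J h' ≫ powProj J h = powProj J (h.trans h') := by
  ext
  rfl

/-- For all `n`, each class in `Ext^i(R ⧸ J^n, N)` becomes zero in `Ext^i(R ⧸ J^m, N)` for some
`m ≥ n`; that is, the direct limit of these groups is zero. -/
def ExtDies (J : Ideal R) (i : ℕ) (N : Type u) [AddCommGroup N] [Module R N] : Prop :=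
  ∀ n, ∀ α : Abelian.Ext (ModuleCat.of R (R ⧸ J ^ n)) (ModuleCat.of R N) i,
    ∃ m, ∃ h : n ≤ m, (Abelian.Ext.mk₀ (powProj J h)).comp α (zero_add i) = 0

theorem subsingleton_lc_iff (J : Ideal R) (i : ℕ) (N : Type u) [AddCommGroup N] [Module R N] :
    Subsingleton (lc J i N) ↔ ExtDies J i N := by
  let F := localCohomology.diagram (localCohomology.idealPowersDiagram J) i
  let D := F ⋙ (evaluation _ _).obj (ModuleCat.of R N)
  have : PreservesFilteredColimitsOfSize.{0, 0} (forget (ModuleCat.{u} R)) :=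
    preservesFilteredColimitsOfSize_shrink.{0, u, 0, u} _
  have hc := isColimitOfPreserves ((evaluation _ _).obj (ModuleCat.of R N)) (colimit.isColimit F)
  trans ∀ n : ℕ, ∀ e : D.obj (op (op n)), ∃ j : {m // n ≤ m},
    D.map (homOfLE j.2).op.op e = 0
  · constructor
    · intro H n e
      obtain ⟨k, f, g, h⟩ := (Concrete.isColimit_rep_eq_iff_exists D hc
        (i := op (op n)) (j := op (op n)) e 0).1 (H.elim _ _)
      rw [map_zero] at h
      exact ⟨⟨k.unop.unop, leOfHom f.unop.unop⟩, h⟩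
    · intro H
      refine ⟨fun x y => ?_⟩
      have h0 : ∀ x : (lc J i N), x = 0 := by
        intro x
        obtain ⟨k, e, rfl⟩ := Concrete.isColimit_exists_rep D hc x
        obtain ⟨j, hj⟩ := H k.unop.unop e
        refine (Concrete.isColimit_rep_eq_of_exists D e (0 : D.obj k)
          ⟨_, (homOfLE j.2).op.op, (homOfLE j.2).op.op, ?_⟩).trans (map_zero _)
        rw [map_zero]
        exact hj
      rw [h0 x, h0 y]
  · refine forall_congr' fun n => ?_
    refine (extFunctor_eventually_zero_iff (fun j : {m // n ≤ m} => powProj J j.2) _ i).trans ?_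
    simp only [Subtype.exists]
end LocalCohomologyAsLimit

/-! ### Local cohomology and regular elements -/

section RegularElements
open CategoryTheory Opposite Limits Abelian

variable {R : Type u} [CommRing R] {J : Ideal R} {N N' : Type u} [AddCommGroup N] [Module R N]
  [AddCommGroup N'] [Module R N']

theorem shortExact_lsmul {x : R} (hx : IsSMulRegular N x)
    (f : N →ₗ[R] N') (hf : Function.Surjective f) (hfx : ∀ z, f z = 0 ↔ ∃ y, x • y = z) :
    (ShortComplex.mk (ModuleCat.ofHom (LinearMap.lsmul R N x)) (ModuleCat.ofHom f) (by
      ext z; exact (hfx _).2 ⟨z, rfl⟩)).ShortExact := by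
  refine ModuleCat.shortComplex_shortExact _ (fun z => hfx z) hx hf

theorem ofHom_lsmul_eq (x : R) :
    ModuleCat.ofHom (LinearMap.lsmul R N x) = x • 𝟙 (ModuleCat.of R N) := rfl

theorem ExtDies.quotient {x : R} (hx : IsSMulRegular N x)
    (f : N →ₗ[R] N') (hf : Function.Surjective f) (hfx : ∀ z, f z = 0 ↔ ∃ y, x • y = z) {i : ℕ}
    (h : ExtDies J i N) (h' : ExtDies J (i + 1) N) : ExtDies J i N' := by
  intro n α
  have hS := shortExact_lsmul hx f hf hfx
  obtain ⟨m, hm, hα⟩ := h' n (α.comp hS.extClass rfl)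
  rw [← Ext.comp_assoc _ _ _ (zero_add i) rfl (by lia)] at hα
  obtain ⟨β, hβ⟩ := Ext.covariant_sequence_exact₃ _ hS _ rfl hα
  obtain ⟨l, hl, hβ'⟩ := h m β
  refine ⟨l, hm.trans hl, ?_⟩
  rw [← powProj_comp J hm hl, ← Ext.mk₀_comp_mk₀_assoc, ← hβ,
    ← Ext.comp_assoc_of_third_deg_zero, hβ', Ext.zero_comp]

/-- `Ext^i(R ⧸ J^n, N)` is killed by `J^n`. -/
theorem ext_smul_eq_zero {n i : ℕ} {x : R} (hx : x ∈ J ^ n)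
    (α : Ext (ModuleCat.of R (R ⧸ J ^ n)) (ModuleCat.of R N) i) : x • α = 0 := by
  have h := Ext.postcomp_smul_id_eq_zero_of_mem_annihilator (M := ModuleCat.of R N)
    (N := ModuleCat.of R (R ⧸ J ^ n)) (r := x)
    (by change x ∈ Module.annihilator R (R ⧸ J ^ n); rwa [Ideal.annihilator_quotient]) i
  have := congr($h α)
  simpa [Ext.mk₀_smul] using this

/-- If the classes killed by `x ∈ J` die along the powers of `J`, then every class dies, as every
class is killed by a power of `x`. -/
theorem extDies_of_smul {x : R} (hx : x ∈ J) {i : ℕ}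
    (h : ∀ n, ∀ γ : Ext (ModuleCat.of R (R ⧸ J ^ n)) (ModuleCat.of R N) i, x • γ = 0 →
      ∃ m, ∃ h : n ≤ m, (Ext.mk₀ (powProj J h)).comp γ (zero_add i) = 0) : ExtDies J i N := by
  have key : ∀ k n, ∀ γ : Ext (ModuleCat.of R (R ⧸ J ^ n)) (ModuleCat.of R N) i, x ^ k • γ = 0 →
      ∃ m, ∃ h : n ≤ m, (Ext.mk₀ (powProj J h)).comp γ (zero_add i) = 0 := by
    intro k
    induction k with
    | zero =>
      exact fun n γ hγ => ⟨n, le_rfl, by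
        rw [pow_zero, one_smul] at hγ
        rw [hγ, Ext.comp_zero]⟩
    | succ k ih =>
      intro n γ hγ
      rw [pow_succ, mul_smul] at hγ
      obtain ⟨m, hm, h1⟩ := ih n (x • γ) hγ
      rw [Ext.comp_smul] at h1
      obtain ⟨l, hl, h2⟩ := h m _ h1
      refine ⟨l, hm.trans hl, ?_⟩
      rw [← powProj_comp J hm hl, ← Ext.mk₀_comp_mk₀_assoc, h2]
  exact fun n γ => key n n γ (ext_smul_eq_zero (Ideal.pow_mem_pow hx n) γ)

theorem ExtDies.succ {x : R} (hxJ : x ∈ J) (hx : IsSMulRegular N x)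
    (f : N →ₗ[R] N') (hf : Function.Surjective f) (hfx : ∀ z, f z = 0 ↔ ∃ y, x • y = z) {i : ℕ}
    (h : ExtDies J i N') : ExtDies J (i + 1) N := by
  refine extDies_of_smul hxJ fun n γ hγ => ?_
  have hS := shortExact_lsmul hx f hf hfx
  obtain ⟨β, rfl⟩ := Ext.covariant_sequence_exact₁ _ hS γ
    (by simpa [ofHom_lsmul_eq, Ext.mk₀_smul] using hγ) rfl
  obtain ⟨m, hm, hβ⟩ := h n β
  refine ⟨m, hm, ?_⟩
  rw [← Ext.comp_assoc _ _ _ (zero_add i) rfl (by lia), hβ, Ext.zero_comp]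

theorem extDies_zero {x : R} (hxJ : x ∈ J) (hx : IsSMulRegular N x) : ExtDies J 0 N := by
  refine extDies_of_smul hxJ fun n γ hγ => ⟨n, le_rfl, ?_⟩
  obtain ⟨φ, rfl⟩ := (Ext.mk₀_bijective _ _).2 γ
  rw [← Ext.mk₀_smul, ← Ext.mk₀_zero, (Ext.mk₀_bijective _ _).1.eq_iff] at hγ
  have : φ = 0 := by
    refine ModuleCat.hom_ext (LinearMap.ext fun z => ?_)
    exact hx (congr($hγ z).trans (smul_zero x).symm)
  rw [this, Ext.mk₀_zero, Ext.comp_zero]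

theorem ExtDies.eq_zero (h : ExtDies J 0 N) (z : N) (hz : ∀ r ∈ J, r • z = 0) : z = 0 := by
  have hz' : J ^ 1 ≤ LinearMap.ker (LinearMap.toSpanSingleton R N z) := by
    rw [pow_one]
    exact hz
  let φ : ModuleCat.of R (R ⧸ J ^ 1) ⟶ ModuleCat.of R N :=
    ModuleCat.ofHom (Submodule.liftQ _ (LinearMap.toSpanSingleton R N z) hz')
  obtain ⟨m, hm, h0⟩ := h 1 (Ext.mk₀ φ)
  rw [Ext.mk₀_comp_mk₀, ← Ext.mk₀_zero, (Ext.mk₀_bijective _ _).1.eq_iff] at h0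
  have := congr($h0 (Submodule.Quotient.mk 1))
  simpa using (one_smul R z).symm.trans this

/-- The local cohomology modules `H^i_J(N)` vanish for all `i < s`. -/
def LcVanish (J : Ideal R) (s : ℕ) (N : Type u) [AddCommGroup N] [Module R N] : Prop :=
  ∀ i < s, Subsingleton (lc J i N)

/-- Dividing by an `N`-regular element `x ∈ J` lowers the range of vanishing by one. Here the
quotient `N ⧸ x N` is presented by a surjection `f` with kernel `x N`. -/
theorem lcVanish_succ_iff {x : R} (hxJ : x ∈ J) (hx : IsSMulRegular N x)
    (f : N →ₗ[R] N') (hf : Function.Surjective f) (hfx : ∀ z, f z = 0 ↔ ∃ y, x • y = z) {s : ℕ} :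
    LcVanish J (s + 1) N ↔ LcVanish J s N' := by
  simp only [LcVanish, subsingleton_lc_iff]
  constructor
  · exact fun h i hi => (h i (by lia)).quotient hx f hf hfx (h (i + 1) (by lia))
  · rintro h (_ | i) hi
    · exact extDies_zero hxJ hx
    · exact (h i (by lia)).succ hxJ hx f hf hfx

theorem LcVanish.eq_zero {s : ℕ} (h : LcVanish J (s + 1) N) {z : N} (hz : ∀ r ∈ J, r • z = 0) :
    z = 0 :=
  ((subsingleton_lc_iff J 0 N).1 (h 0 s.succ_pos)).eq_zero z hz

theorem exists_isSMulRegular_of_mem [IsNoetherianRing R] [Module.Finite R N]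
    (h : ∀ z : N, (∀ r ∈ J, r • z = 0) → z = 0) : ∃ x ∈ J, IsSMulRegular N x := by
  have : Subsingleton ((R ⧸ J) →ₗ[R] N) := by
    refine subsingleton_of_forall_eq 0 fun φ => ?_
    ext
    refine h (φ (Submodule.Quotient.mk 1)) fun r hr => ?_
    rw [← map_smul, ← Submodule.Quotient.mk_smul,
      (Submodule.Quotient.mk_eq_zero _).2 (by simpa using hr), map_zero]
  simpa [Ideal.annihilator_quotient] using IsSMulRegular.subsingleton_linearMap_iff.1 this

open Pointwise in
theorem smul_top_quotSMulTop_ne_top {R : Type*} [CommRing R] {J : Ideal R} {N : Type*}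
    [AddCommGroup N] [Module R N] {x : R} (hxJ : x ∈ J) (hJ : J • (⊤ : Submodule R N) ≠ ⊤) :
    J • (⊤ : Submodule R (QuotSMulTop x N)) ≠ ⊤ := by
  intro h
  refine hJ ?_
  have := congrArg (Submodule.comap (Submodule.mkQ _)) h
  simpa [Submodule.comap_smul_top_of_surjective J _ (Submodule.mkQ_surjective _),
    Submodule.smul_mono_left ((Ideal.span_singleton_le_iff_mem J).mpr hxJ),
    ← Submodule.ideal_span_singleton_smul] using this

open RingTheory.Sequence Pointwise in
/-- Over a Noetherian ring, the local cohomology of a finitely generated module `N` with `J N ≠ N`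
vanishes below `s` if and only if `J` contains an `N`-regular sequence of length `s`. -/
theorem lcVanish_iff_exists_isRegular [IsNoetherianRing R] [Module.Finite R N]
    (hJ : J • (⊤ : Submodule R N) ≠ ⊤) (s : ℕ) :
    LcVanish J s N ↔ ∃ rs : List R, rs.length = s ∧ (∀ r ∈ rs, r ∈ J) ∧ IsRegular N rs := by
  induction s generalizing N with
  | zero =>
    have : Nontrivial N := (Submodule.nontrivial_iff R).mp (nontrivial_of_lt _ _ hJ.lt_top)
    exact iff_of_true (by intro i hi; lia) ⟨[], by simp [isRegular_iff]⟩
  | succ s ih =>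
    have step {x : R} (hxJ : x ∈ J) (hx : IsSMulRegular N x) :
        LcVanish J (s + 1) N ↔ LcVanish J s (QuotSMulTop x N) :=
      lcVanish_succ_iff hxJ hx (Submodule.mkQ _) (Submodule.mkQ_surjective _) fun z => by
        simpa using! Submodule.mem_smul_pointwise_iff_exists z x ⊤
    constructor
    · intro h
      obtain ⟨x, hxJ, hx⟩ := exists_isSMulRegular_of_mem fun z => h.eq_zero (z := z)
      obtain ⟨rs, hrs, hmem, hreg⟩ :=
        (ih (smul_top_quotSMulTop_ne_top hxJ hJ)).1 ((step hxJ hx).1 h)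
      exact ⟨x :: rs, by simp [hrs], by simpa [hxJ] using hmem,
        (isRegular_cons_iff _ _ _).2 ⟨hx, hreg⟩⟩
    · rintro ⟨_ | ⟨x, rs⟩, hrs, hmem, hreg⟩
      · simp at hrs
      · rw [isRegular_cons_iff] at hreg
        have hxJ := hmem x (by simp)
        exact (step hxJ hreg.1).2 ((ih (smul_top_quotSMulTop_ne_top hxJ hJ)).2
          ⟨rs, by simpa using hrs, fun r hr => hmem r (by simp [hr]), hreg.2⟩)
end RegularElements

noncomputable section

open Polynomial Pointwise

/-! ### Avoiding submodules over a local ring with infinite residue field -/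

section Cover

theorem infinite_of_nontrivial_of_infinite_residueField (A : Type*) [CommRing A] [IsLocalRing A]
    [Infinite (IsLocalRing.ResidueField A)] (E : Type*) [AddCommGroup E] [Module A E]
    [Nontrivial E] :
    Infinite E := by
  by_contra hE
  rw [not_infinite_iff_finite] at hE
  obtain ⟨y, hy⟩ := exists_ne (0 : E)
  have hle : LinearMap.ker (LinearMap.toSpanSingleton A E y) ≤ IsLocalRing.maximalIdeal A :=
    IsLocalRing.le_maximalIdeal fun h => hy <| by
      simpa using (Ideal.eq_top_iff_one _).1 h
  have : Finite (A ⧸ LinearMap.ker (LinearMap.toSpanSingleton A E y)) :=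
    Finite.of_injective _ (LinearMap.ker_eq_bot.1
      (Submodule.ker_liftQ_eq_bot' _ (LinearMap.toSpanSingleton A E y) rfl))
  have : Finite (IsLocalRing.ResidueField A) :=
    Finite.of_surjective _ (Ideal.Quotient.factor_surjective hle)
  exact not_finite (IsLocalRing.ResidueField A)

/-- A module over a local ring with infinite residue field is not a finite union of proper
submodules: one of them would have finite index, but nonzero modules over such a ring are
infinite. -/
theorem exists_forall_notMem_of_infinite_residueField {A : Type*} [CommRing A] [IsLocalRing A]
    [Infinite (IsLocalRing.ResidueField A)] {E : Type*} [AddCommGroup E] [Module A E]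
    {ι : Type*} (s : Finset ι) (p : ι → Submodule A E) (hp : ∀ i ∈ s, p i ≠ ⊤) :
    ∃ y, ∀ i ∈ s, y ∉ p i := by
  by_contra! h
  obtain ⟨k, hk, hfin⟩ := Submodule.exists_finiteIndex_of_cover (p := p) (s := s)
    (Set.eq_univ_of_forall fun y => by simpa using h y)
  have : Finite (E ⧸ p k) := AddSubgroup.finite_quotient_of_finiteIndex
  have : Nontrivial (E ⧸ p k) := Submodule.Quotient.nontrivial_iff.mpr (hp k hk)
  have := infinite_of_nontrivial_of_infinite_residueField A (E ⧸ p k)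
  exact not_finite (E ⧸ p k)

end Cover

/-! ### The modules `L^I(M)` and `L^I(M / x M)` -/

section Rees
variable {A : Type u} [CommRing A] (I : Ideal A) {M N : Type u} [AddCommGroup M] [Module A M]
  [AddCommGroup N] [Module A N]

/-- The element `x t` of the Rees ring. -/
def degOne (x : I) : reesAlgebra I :=
  ⟨monomial 1 (x : A), reesAlgebra.monomial_mem.2 (by simp)⟩

theorem degOne_mem_reesPlus (x : I) : degOne I x ∈ reesPlus I := by
  change coeff (monomial 1 (x : A)) 0 = 0
  simp [coeff_monomial]

/-- The ideal `R₊` is generated by its elements of degree one. -/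
theorem reesPlus_le {P : Ideal (reesAlgebra I)} (h : ∀ x : I, degOne I x ∈ P) :
    reesPlus I ≤ P := by
  -- `Iⁿ⁺¹` is generated by the products `x b` with `x ∈ I` and `b ∈ Iⁿ`, and
  -- `x b tⁿ⁺¹ = (b tⁿ) (x t)`.
  have key (n : ℕ) (a : A) (ha : a ∈ I ^ (n + 1)) :
      (⟨monomial (n + 1) a, reesAlgebra.monomial_mem.2 ha⟩ : reesAlgebra I) ∈ P := by
    have : ∃ _ : a ∈ I ^ (n + 1),
      (⟨monomial (n + 1) a, reesAlgebra.monomial_mem.2 ‹_›⟩ : reesAlgebra I) ∈ P := by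
      rw [pow_succ'] at ha
      induction ha using Submodule.mul_induction_on' with
      | mem_mul_mem x hx b hb =>
        refine ⟨by rw [pow_succ']; exact Ideal.mul_mem_mul hx hb, ?_⟩
        convert P.mul_mem_left ⟨monomial n b, reesAlgebra.monomial_mem.2 hb⟩ (h ⟨x, hx⟩)
        simp [degOne, monomial_mul_monomial, mul_comm]
      | add x _ y _ hx hy =>
        obtain ⟨hx, hx'⟩ := hx
        obtain ⟨hy, hy'⟩ := hy
        refine ⟨add_mem hx hy, ?_⟩
        convert P.add_mem hx' hy'
        simp
    exact this.2
  intro f hf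
  have hf0 : (f : A[X]).coeff 0 = 0 := hf
  have hsum : f = ∑ n ∈ (f : A[X]).support,
      (⟨monomial n ((f : A[X]).coeff n), reesAlgebra.monomial_mem.2 (f.2 n)⟩ : reesAlgebra I) := by
    refine Subtype.ext ?_
    rw [AddSubmonoidClass.coe_finsetSum]
    exact (f : A[X]).as_sum_support
  rw [hsum]
  refine P.sum_mem fun n hn => ?_
  cases n with
  | zero => exact absurd hf0 (mem_support_iff.1 hn)
  | succ n => exact key n _ (f.2 (n + 1))

theorem coeff_sub (p q : PolynomialModule A M) (n : ℕ) :
    (p - q).coeff n = p.coeff n - q.coeff n := rfl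

theorem coeff_degOne_smul_zero (x : I) (f : PolynomialModule A M) :
    (degOne I x • f).coeff 0 = 0 := by
  rw [Subalgebra.smul_def]
  simp [degOne]

theorem coeff_degOne_smul_succ (x : I) (f : PolynomialModule A M) (n : ℕ) :
    (degOne I x • f).coeff (n + 1) = (x : A) • f.coeff n := by
  rw [Subalgebra.smul_def]
  simp [degOne]

variable (M) in
/-- For `x ∈ I`, the class of `x` in `I / I²` is a nonzerodivisor on `G_I(M)`, tested on homogeneous
elements. -/
def InitialRegular (x : A) : Prop :=
  ∀ n, ∀ m ∈ I ^ n • (⊤ : Submodule A M), x • m ∈ I ^ (n + 2) • (⊤ : Submodule A M) →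
    m ∈ I ^ (n + 1) • (⊤ : Submodule A M)

variable {I}

/-- If the initial form of `x` is a nonzerodivisor on `G_I(M)`, then `(Iⁿ⁺¹ M : x) ⊆ Iⁿ M`. -/
theorem InitialRegular.mem_of_smul_mem {x : A} (h : InitialRegular I M x) {n : ℕ} {m : M}
    (hm : x • m ∈ I ^ (n + 1) • (⊤ : Submodule A M)) : m ∈ I ^ n • (⊤ : Submodule A M) := by
  induction n with
  | zero => simp
  | succ n ih =>
    exact h n m (ih (Submodule.smul_mono_left (Ideal.pow_le_pow_right (by lia)) hm)) hm

/-- An element killed by `x` lies in every `Iⁿ M`, so it is zero by Krull's intersection theorem. -/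
theorem InitialRegular.isSMulRegular [IsNoetherianRing A] [IsLocalRing A] [Module.Finite A M]
    (hI : I ≠ ⊤) {x : A} (h : InitialRegular I M x) : IsSMulRegular M x := by
  rw [isSMulRegular_iff_right_eq_zero_of_smul]
  intro m hm
  rw [← Submodule.mem_bot A, ← Ideal.iInf_pow_smul_eq_bot_of_isLocalRing I hI, Submodule.mem_iInf]
  exact fun n => h.mem_of_smul_mem (by rw [hm]; exact Submodule.zero_mem _)

variable (I)

/-- The map `M[t] → N[t]` induced by `f : M → N`, as a map of `R(I)`-modules. -/
def polyMap (f : M →ₗ[A] N) : PolynomialModule A M →ₗ[reesAlgebra I] PolynomialModule A N where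
  toFun := PolynomialModule.map A f
  map_add' := map_add _
  map_smul' r p := by
    rw [Subalgebra.smul_def, PolynomialModule.map_smul]
    simp [Subalgebra.smul_def]

theorem coeff_polyMap (f : M →ₗ[A] N) (p : PolynomialModule A M) (n : ℕ) :
    (polyMap I f p).coeff n = f (p.coeff n) := rfl

theorem polyMap_mem {k : ℕ} (f : M →ₗ[A] N) {p : PolynomialModule A M}
    (hp : p ∈ reesModuleShift I M k) : polyMap I f p ∈ reesModuleShift I N k := fun n => by
  rw [coeff_polyMap]
  have := Submodule.mem_map_of_mem (f := f) (hp n)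
  rw [Submodule.map_smul''] at this
  exact Submodule.smul_mono le_rfl le_top this

/-- The map `L^I(M) → L^I(N)` induced by `f : M → N`. -/
def lModuleMap (f : M →ₗ[A] N) : LModule I M →ₗ[reesAlgebra I] LModule I N :=
  Submodule.mapQ _ _ (polyMap I f) fun _ hp => polyMap_mem I f hp

theorem lModuleMap_mkQ (f : M →ₗ[A] N) (p : PolynomialModule A M) :
    lModuleMap I f ((reesModuleShift I M 1).mkQ p) =
      (reesModuleShift I N 1).mkQ (polyMap I f p) := rfl

theorem polyMap_surjective {f : M →ₗ[A] N} (hf : Function.Surjective f) :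
    Function.Surjective (polyMap I f) := by
  intro p
  induction p using PolynomialModule.induction_linear with
  | zero => exact ⟨0, map_zero _⟩
  | add p q hp hq =>
    obtain ⟨p, rfl⟩ := hp
    obtain ⟨q, rfl⟩ := hq
    exact ⟨p + q, map_add _ _ _⟩
  | single n m =>
    obtain ⟨m, rfl⟩ := hf m
    exact ⟨PolynomialModule.single A n m, PolynomialModule.map_single A f n m⟩

theorem lModuleMap_surjective {f : M →ₗ[A] N} (hf : Function.Surjective f) :
    Function.Surjective (lModuleMap I f) := by
  intro z
  obtain ⟨p, rfl⟩ := Submodule.mkQ_surjective _ z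
  obtain ⟨p, rfl⟩ := polyMap_surjective I hf p
  exact ⟨_, lModuleMap_mkQ I f p⟩

variable {I}

theorem isSMulRegular_LModule {x : I} (h : InitialRegular I M x) :
    IsSMulRegular (LModule I M) (degOne I x) := by
  rw [isSMulRegular_iff_right_eq_zero_of_smul]
  intro z hz
  obtain ⟨p, rfl⟩ := Submodule.mkQ_surjective _ z
  rw [← map_smul, Submodule.mkQ_apply, Submodule.Quotient.mk_eq_zero] at hz
  rw [Submodule.mkQ_apply, Submodule.Quotient.mk_eq_zero]
  intro n
  have := hz (n + 1)
  rw [coeff_degOne_smul_succ] at this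
  exact h.mem_of_smul_mem this

theorem mem_pow_smul_top_quotient_iff {x : A} {n : ℕ} {m : M} :
    (x • (⊤ : Submodule A M)).mkQ m ∈ I ^ n • (⊤ : Submodule A (QuotSMulTop x M)) ↔
      ∃ y, m - x • y ∈ I ^ n • (⊤ : Submodule A M) := by
  rw [← Submodule.mem_comap,
    Submodule.comap_smul_top_of_surjective _ _ (Submodule.mkQ_surjective _), Submodule.ker_mkQ,
    Submodule.mem_sup]
  constructor
  · rintro ⟨a, ha, b, hb, rfl⟩
    obtain ⟨y, -, rfl⟩ := (Submodule.mem_smul_pointwise_iff_exists _ _ _).1 hb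
    exact ⟨y, by simpa⟩
  · rintro ⟨y, hy⟩
    exact ⟨_, hy, x • y, Submodule.smul_mem_pointwise_smul _ _ _ trivial, by simp⟩

/-- If the image of `p` in `(M / x M)[t]` has coefficients in `I^(n+1) (M / x M)`, then `p` is
congruent to a multiple of `x t`. -/
theorem exists_sub_degOne_smul_mem {x : I} {p : PolynomialModule A M}
    (hp : polyMap I ((x : A) • (⊤ : Submodule A M)).mkQ p ∈ reesModuleShift I _ 1) :
    ∃ q, p - degOne I x • q ∈ reesModuleShift I M 1 := by
  have h n := mem_pow_smul_top_quotient_iff.1 (hp n)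
  choose y hy using fun n => h (n + 1)
  obtain ⟨B, hB⟩ := p.coeff.support.exists_nat_subset_range
  refine ⟨∑ n ∈ Finset.range B, PolynomialModule.single A n (y n), fun n => ?_⟩
  cases n with
  | zero =>
    obtain ⟨y, hy⟩ := h 0
    -- in degree `0` the correction `x y` lies in `I M` already
    have hxy : (x : A) • y ∈ I ^ (0 + 1) • (⊤ : Submodule A M) :=
      Submodule.smul_mem_smul (by simp) trivial
    simpa [coeff_sub, coeff_degOne_smul_zero] using Submodule.add_mem _ hy hxy
  | succ n =>
    by_cases hn : n < B
    · simpa [coeff_sub, coeff_degOne_smul_succ, Finsupp.finsetSum_apply, Finsupp.single_apply,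
        hn] using hy n
    · have : p.coeff (n + 1) = 0 := by
        by_contra h0
        have := hB (Finsupp.mem_support_iff.2 h0)
        simp at this
        lia
      simp [coeff_sub, coeff_degOne_smul_succ, Finsupp.finsetSum_apply, Finsupp.single_apply,
        hn, this]

theorem polyMap_degOne_smul (x : I) (q : PolynomialModule A M) :
    polyMap I ((x : A) • (⊤ : Submodule A M)).mkQ (degOne I x • q) = 0 := by
  refine PolynomialModule.ext (Finsupp.ext fun n => ?_)
  rw [coeff_polyMap]
  cases n with
  | zero => rw [coeff_degOne_smul_zero, map_zero]; rfl
  | succ n =>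
    rw [coeff_degOne_smul_succ]
    exact (Submodule.Quotient.mk_eq_zero _).2 (Submodule.smul_mem_pointwise_smul _ _ _ trivial)

/-- The kernel of `L^I(M) → L^I(M / x M)` is `x t · L^I(M)`. -/
theorem lModuleMap_mkQ_eq_zero_iff (x : I) (z : LModule I M) :
    lModuleMap I ((x : A) • (⊤ : Submodule A M)).mkQ z = 0 ↔ ∃ y, degOne I x • y = z := by
  constructor
  · intro h
    obtain ⟨p, rfl⟩ := Submodule.mkQ_surjective _ z
    rw [lModuleMap_mkQ, Submodule.mkQ_apply, Submodule.Quotient.mk_eq_zero] at h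
    obtain ⟨q, hq⟩ := exists_sub_degOne_smul_mem h
    exact ⟨Submodule.mkQ _ q, ((Submodule.Quotient.eq _).2 hq).symm⟩
  · rintro ⟨y, rfl⟩
    obtain ⟨q, rfl⟩ := Submodule.mkQ_surjective _ y
    rw [← map_smul, lModuleMap_mkQ, polyMap_degOne_smul, map_zero]
end Rees

/-! ### The modules `G_I(M)` and `G_I(M / x M)` -/

section GradedModule
variable {A : Type u} [CommRing A] {I : Ideal A} {M N : Type u} [AddCommGroup M] [Module A M]
  [AddCommGroup N] [Module A N]

/-- A shortcut that keeps instance search from unfolding `G_I(M)`. -/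
instance (priority := high) : SMul (AssocGradedRing I) (AssocGradedModule I M) :=
  (assocGradedModuleInst I M).toSMul

instance [IsNoetherianRing A] [Module.Finite A M] :
    Module.Finite (reesAlgebra I) (AssocGradedModule I M) := by
  have h : reesModuleShift I M 0 = (I.stableFiltration ⊤).submodule := rfl
  have hfg : (reesModuleShift I M 0).FG := by
    rw [h, Ideal.Filtration.submodule_fg_iff_stable]
    · exact I.stableFiltration_stable ⊤
    · exact fun i => IsNoetherian.noetherian _
  exact Module.Finite.iff_fg.2 (hfg.map _)

instance [IsNoetherianRing A] [Module.Finite A M] :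
    Module.Finite (AssocGradedRing I) (AssocGradedModule I M) :=
  Module.Finite.of_surjective (assocGradedModule_isTorsionBySet I M).semilinearMap
    Function.surjective_id

variable (I) in
/-- The map `G_I(M) → G_I(N)` induced by `f : M → N`. -/
def assocGradedMap (f : M →ₗ[A] N) :
    AssocGradedModule I M →ₗ[AssocGradedRing I] AssocGradedModule I N where
  toFun z := ⟨lModuleMap I f z, by
    obtain ⟨_, p, hp, rfl⟩ := z
    exact ⟨polyMap I f p, polyMap_mem I f hp, rfl⟩⟩
  map_add' y z := Subtype.ext (map_add (lModuleMap I f) _ _)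
  map_smul' r z := by
    obtain ⟨r, rfl⟩ := Ideal.Quotient.mk_surjective r
    exact Subtype.ext (map_smul (lModuleMap I f) r z.1)

theorem assocGradedMap_surjective {f : M →ₗ[A] N} (hf : Function.Surjective f) :
    Function.Surjective (assocGradedMap I f) := by
  rintro ⟨_, p, hp, rfl⟩
  have key (n : ℕ) : ∃ m ∈ I ^ n • (⊤ : Submodule A M), f m = p.coeff n := by
    have h := hp n
    rw [← LinearMap.range_eq_top.2 hf, LinearMap.range_eq_map, ← Submodule.map_smul''] at h
    exact h
  choose y hy hyp using key
  have hq (n : ℕ) : (∑ k ∈ p.coeff.support, PolynomialModule.single A k (y k)).coeff n =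
      if n ∈ p.coeff.support then y n else 0 := by
    simp [Finsupp.finsetSum_apply, Finsupp.single_apply]
  refine ⟨⟨_, ∑ k ∈ p.coeff.support, PolynomialModule.single A k (y k), fun n => ?_, rfl⟩,
    Subtype.ext (congrArg (Submodule.mkQ _) (PolynomialModule.ext (Finsupp.ext fun n => ?_)))⟩
  · rw [hq]
    split_ifs
    · exact hy n
    · exact Submodule.zero_mem _
  · rw [coeff_polyMap, hq]
    split_ifs with h
    · exact hyp n
    · rw [map_zero, Finsupp.notMem_support_iff.1 h]

/-- The degree one initial form of `x` in `G_I(A)`. -/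
def initialForm (x : I) : AssocGradedRing I := Ideal.Quotient.mk _ (degOne I x)

theorem initialForm_mem_assocGradedPlus (x : I) : initialForm x ∈ assocGradedPlus I :=
  Ideal.mem_map_of_mem _ (degOne_mem_reesPlus I x)

theorem InitialRegular.isSMulRegular_initialForm {x : I} (h : InitialRegular I M x) :
    IsSMulRegular (AssocGradedModule I M) (initialForm x) := fun _ _ hyz =>
  Subtype.ext (isSMulRegular_LModule h (congrArg (Subtype.val : AssocGradedModule I M → _) hyz))

/-- Regularity of `x t` is tested on the homogeneous elements `m tⁿ`. -/
theorem initialRegular_of_isSMulRegular {x : I}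
    (h : IsSMulRegular (AssocGradedModule I M) (degOne I x)) : InitialRegular I M x := by
  intro n m hm hxm
  have hp : PolynomialModule.single A n m ∈ reesModuleShift I M 0 := fun k => by
    rw [PolynomialModule.coeff_single, Finsupp.single_apply]
    split_ifs with hk
    · exact hk ▸ hm
    · exact Submodule.zero_mem _
  have h0 : (⟨_, _, hp, rfl⟩ : AssocGradedModule I M) = 0 := by
    refine (isSMulRegular_iff_right_eq_zero_of_smul.1 h) _ (Subtype.ext ?_)
    refine (Submodule.Quotient.mk_eq_zero _).2 fun k => ?_
    cases k with
    | zero =>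
      rw [coeff_degOne_smul_zero]
      exact Submodule.zero_mem _
    | succ k =>
      rw [coeff_degOne_smul_succ, PolynomialModule.coeff_single, Finsupp.single_apply]
      split_ifs with hk
      · exact hk ▸ hxm
      · rw [smul_zero]
        exact Submodule.zero_mem _
  have := (Submodule.Quotient.mk_eq_zero _).1 (congrArg Subtype.val h0) n
  simpa using this

/-- If the initial form of `x` is a nonzerodivisor on `G_I(M)`, then its multiples are the kernel of
`G_I(M) → G_I(M / x M)`. -/
theorem assocGradedMap_mkQ_eq_zero_iff {x : I} (h : InitialRegular I M x)
    (z : AssocGradedModule I M) :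
    assocGradedMap I ((x : A) • (⊤ : Submodule A M)).mkQ z = 0 ↔
      ∃ y : AssocGradedModule I M, initialForm x • y = z := by
  rw [← Submodule.coe_eq_zero]
  refine (lModuleMap_mkQ_eq_zero_iff x z.1).trans ⟨?_, ?_⟩
  · rintro ⟨y, hy⟩
    obtain ⟨_, p, hp, rfl⟩ := z
    obtain ⟨q, rfl⟩ := Submodule.mkQ_surjective _ y
    refine ⟨⟨(reesModuleShift I M 1).mkQ q, q, fun n => ?_, rfl⟩, Subtype.ext hy⟩
    have h1 := Submodule.sub_mem _ (hp (n + 1))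
      (Submodule.smul_mono_left (Ideal.pow_le_pow_right (by lia))
        ((Submodule.Quotient.eq _).1 hy.symm (n + 1)))
    rw [coeff_sub, sub_sub_cancel, coeff_degOne_smul_succ] at h1
    exact h.mem_of_smul_mem h1
  · rintro ⟨y, rfl⟩
    exact ⟨y.1, rfl⟩

/-- If no nonzero element of `G_I(M)` is killed by `R₊`, then some `x ∈ I` has a degree one initial
form which is a nonzerodivisor on `G_I(M)`. -/
theorem exists_initialRegular [IsNoetherianRing A] [IsLocalRing A]
    [Infinite (IsLocalRing.ResidueField A)] [Module.Finite A M]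
    (h : ∀ z : AssocGradedModule I M, (∀ r ∈ reesPlus I, r • z = 0) → z = 0) :
    ∃ x : I, InitialRegular I M x := by
  let φ : I →ₗ[A] reesAlgebra I :=
    { toFun := degOne I
      map_add' := fun x y => Subtype.ext (by simp [degOne])
      map_smul' := fun a x => Subtype.ext (by simp [degOne, smul_monomial]) }
  -- For an associated prime `P`, the `x ∈ I` with `x t ∈ P` form a submodule of `I`. It is proper,
  -- as otherwise `R₊ ⊆ P` and `R₊` would kill a nonzero element.
  have hfin := associatedPrimes.finite (reesAlgebra I) (AssocGradedModule I M)
  obtain ⟨x, hx⟩ := exists_forall_notMem_of_infinite_residueField hfin.toFinset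
    (fun P => (P.restrictScalars A).comap φ) fun P hP htop => by
      have hP : IsAssociatedPrime P _ := hfin.mem_toFinset.1 hP
      obtain ⟨hprime, z, hz⟩ := isAssociatedPrime_iff.1 hP
      have hle : reesPlus I ≤ P := reesPlus_le I fun x => by
        have : x ∈ (P.restrictScalars A).comap φ := htop ▸ trivial
        exact this
      have hz0 : z = 0 := h z fun r hr => by
        have := hz ▸ hle hr
        simpa using this
      refine hprime.ne_top ((Ideal.eq_top_iff_one _).2 ?_)
      rw [hz, hz0]
      simp
  refine ⟨x, initialRegular_of_isSMulRegular ?_⟩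
  by_contra hreg
  have : degOne I x ∈ ⋃ P ∈ associatedPrimes (reesAlgebra I) (AssocGradedModule I M),
      (P : Set (reesAlgebra I)) := by
    rw [biUnion_associatedPrimes_eq_compl_regular]
    exact hreg
  simp only [Set.mem_iUnion] at this
  obtain ⟨P, hP, hxP⟩ := this
  exact hx P (hfin.mem_toFinset.2 hP) hxP

end GradedModule

/-! ### Grade and vanishing of local cohomology -/

section Grade
variable {R : Type*} [CommRing R] {J : Ideal R} {N : Type*} [AddCommGroup N] [Module R N]

theorem le_grade {rs : List R} (h : ∀ r ∈ rs, r ∈ J) (hrs : RingTheory.Sequence.IsRegular N rs) :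
    (rs.length : ℕ∞) ≤ grade J N := by
  unfold grade
  split_ifs
  · exact le_top
  · exact le_iSup₂_of_le rs ⟨h, hrs⟩ le_rfl

theorem grade_le (hJ : J • (⊤ : Submodule R N) ≠ ⊤) {a : ℕ}
    (h : ∀ rs : List R, (∀ r ∈ rs, r ∈ J) → RingTheory.Sequence.IsRegular N rs → rs.length ≤ a) :
    grade J N ≤ a := by
  rw [grade, if_neg hJ]
  exact iSup₂_le fun rs hrs => by exact_mod_cast h rs hrs.1 hrs.2

theorem smul_top_ne_top_of_grade_ne_top (h : grade J N ≠ ⊤) : J • (⊤ : Submodule R N) ≠ ⊤ :=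
  fun hJ => h (by rw [grade, if_pos hJ])

/-- A proper additive subgroup `C` of `N` that contains all `r z` with `r ∈ J` witnesses
`J N ≠ N`. -/
theorem smul_top_ne_top_of_smul_mem (C : AddSubgroup N) {y : N} (hy : y ∉ C)
    (h : ∀ r ∈ J, ∀ z : N, r • z ∈ C) : J • (⊤ : Submodule R N) ≠ ⊤ := fun htop =>
  hy (Submodule.smul_induction_on (p := (· ∈ C)) (by rw [htop]; trivial)
    (fun r hr z _ => h r hr z) fun _ _ => C.add_mem)

theorem grade_eq_of_lcVanish {R : Type u} [CommRing R] [IsNoetherianRing R] {J : Ideal R}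
    {N : Type u} [AddCommGroup N] [Module R N] [Module.Finite R N]
    (hJ : J • (⊤ : Submodule R N) ≠ ⊤) {a : ℕ} (ha : LcVanish J a N)
    (hmax : ∀ s, LcVanish J s N → s ≤ a) : grade J N = a := by
  refine le_antisymm (grade_le hJ fun rs hmem hrs =>
    hmax _ ((lcVanish_iff_exists_isRegular hJ _).2 ⟨rs, rfl, hmem, hrs⟩)) ?_
  obtain ⟨rs, rfl, hmem, hrs⟩ := (lcVanish_iff_exists_isRegular hJ a).1 ha
  exact le_grade hmem hrs

end Grade

/-! ### Comparing the ranges of vanishing -/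

section Graded
variable {A : Type u} [CommRing A] {I : Ideal A} {M N : Type u} [AddCommGroup M] [Module A M]
  [AddCommGroup N] [Module A N]

theorem lcVanish_LModule_succ_iff {x : I} (h : InitialRegular I M x) (s : ℕ) :
    LcVanish (reesPlus I) (s + 1) (LModule I M) ↔
      LcVanish (reesPlus I) s (LModule I (QuotSMulTop (x : A) M)) :=
  lcVanish_succ_iff (degOne_mem_reesPlus I x) (isSMulRegular_LModule h)
    (lModuleMap I ((x : A) • (⊤ : Submodule A M)).mkQ)
    (lModuleMap_surjective I (Submodule.mkQ_surjective _))
    (lModuleMap_mkQ_eq_zero_iff x)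

theorem lcVanish_assocGradedModule_succ_iff {x : I} (h : InitialRegular I M x) (s : ℕ) :
    LcVanish (R := AssocGradedRing I) (assocGradedPlus I) (s + 1) (AssocGradedModule I M) ↔
      LcVanish (R := AssocGradedRing I) (assocGradedPlus I) s
        (AssocGradedModule I (QuotSMulTop (x : A) M)) := by
  have key := lcVanish_succ_iff (R := AssocGradedRing I) (J := assocGradedPlus I)
    (N := AssocGradedModule I M) (N' := AssocGradedModule I (QuotSMulTop (x : A) M))
    (s := s) (initialForm_mem_assocGradedPlus x) h.isSMulRegular_initialForm
    (assocGradedMap I ((x : A) • (⊤ : Submodule A M)).mkQ)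
  have hs := assocGradedMap_surjective (I := I)
    (Submodule.mkQ_surjective ((x : A) • (⊤ : Submodule A M)))
  have hk := assocGradedMap_mkQ_eq_zero_iff h
  have := key hs
  exact this hk

variable (I M) in
/-- The elements of `G_I(M)` whose component in degree `0` vanishes; the condition is imposed on
all their representatives in `M[t]`. -/
def assocGradedModulePlus : AddSubgroup (AssocGradedModule I M) where
  carrier := {z | ∀ p, (reesModuleShift I M 1).mkQ p = z.1 → p.coeff 0 ∈ I • (⊤ : Submodule A M)}
  zero_mem' p hp := by simpa using (Submodule.Quotient.mk_eq_zero _).1 hp 0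
  neg_mem' {z} hz p hp := by
    have := hz (-p) (by rw [map_neg, hp]; exact neg_neg _)
    rw [show (-p).coeff 0 = -p.coeff 0 from rfl] at this
    simpa using this
  add_mem' := by
    rintro ⟨_, q, hq, rfl⟩ ⟨_, q', hq', rfl⟩ h h' p hp
    have h0 := (Submodule.Quotient.eq (reesModuleShift I M 1)).1
      (show Submodule.Quotient.mk p = Submodule.Quotient.mk (q + q') from hp) 0
    rw [coeff_sub] at h0
    have := Submodule.add_mem _ h0 (Submodule.add_mem _
      (by simpa using h q rfl) (by simpa using h' q' rfl))
    rwa [PolynomialModule.coeff_add, Finsupp.add_apply, sub_add_cancel, zero_add, pow_one] at this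

/-- The grade of `G₊` on `G_I(M)` is the number `a` of initial vanishing local cohomology modules.
The hypothesis `G₊ G_I(M) ≠ G_I(M)` of `grade_eq_of_lcVanish` holds as `M / I M ≠ 0` in degree `0`. -/
theorem grade_assocGradedModule_eq [IsNoetherianRing A] [Module.Finite A M]
    (hI : I • (⊤ : Submodule A M) ≠ ⊤) {a : ℕ}
    (ha : LcVanish (R := AssocGradedRing I) (assocGradedPlus I) a (AssocGradedModule I M))
    (hmax : ∀ s, LcVanish (R := AssocGradedRing I) (assocGradedPlus I) s (AssocGradedModule I M) →
      s ≤ a) :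
    grade (R := AssocGradedRing I) (assocGradedPlus I) (AssocGradedModule I M) = a := by
  obtain ⟨m, -, hm⟩ := SetLike.exists_of_lt hI.lt_top
  have hp : PolynomialModule.single A 0 m ∈ reesModuleShift I M 0 := fun k => by
    cases k <;> simp
  refine grade_eq_of_lcVanish (smul_top_ne_top_of_smul_mem (R := AssocGradedRing I)
    (assocGradedModulePlus I M) (y := ⟨(reesModuleShift I M 1).mkQ _, _, hp, rfl⟩)
    (fun h => hm (by simpa using h _ rfl)) ?_) ha hmax
  rintro r hr ⟨_, q, hq, rfl⟩ p hp
  obtain ⟨r, hr', rfl⟩ := (Ideal.mem_map_iff_of_surjective _ Ideal.Quotient.mk_surjective).1 hr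
  have h0 := (Submodule.Quotient.eq (reesModuleShift I M 1)).1
    (show Submodule.Quotient.mk p = Submodule.Quotient.mk (r • q) from hp) 0
  have hr0 : (r : A[X]).coeff 0 = 0 := hr'
  rw [coeff_sub, Subalgebra.smul_def, PolynomialModule.smul_apply] at h0
  simpa [hr0] using h0

variable [IsNoetherianRing A] [IsLocalRing A] [Infinite (IsLocalRing.ResidueField A)]
  [Module.Finite A M]

/-- `H⁰` of `L^I(M)` controls that of its submodule `G_I(M)`. -/
theorem exists_initialRegular_of_lcVanish_LModule {s : ℕ}
    (h : LcVanish (reesPlus I) (s + 1) (LModule I M)) : ∃ x : I, InitialRegular I M x :=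
  exists_initialRegular fun _ hz =>
    Subtype.ext (h.eq_zero fun r hr => congrArg Subtype.val (hz r hr))

theorem exists_initialRegular_of_lcVanish_assocGradedModule {s : ℕ}
    (h : LcVanish (R := AssocGradedRing I) (assocGradedPlus I) (s + 1) (AssocGradedModule I M)) :
    ∃ x : I, InitialRegular I M x :=
  exists_initialRegular fun _ hz => h.eq_zero fun r hr => by
    obtain ⟨r, hr', rfl⟩ := (Ideal.mem_map_iff_of_surjective _ Ideal.Quotient.mk_surjective).1 hr
    exact hz r hr'

variable (I M) in
/-- The local cohomology of `L^I(M)` with support in `R₊` and that of `G_I(M)` with support in `G₊`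
vanish in the same initial range: if either vanishes in degree `0`, then some `x ∈ I` has an initial
form regular on `G_I(M)`, and passing from `M` to `M / x M` shortens both ranges by one. -/
theorem lcVanish_LModule_iff (s : ℕ) :
    LcVanish (reesPlus I) s (LModule I M) ↔
      LcVanish (R := AssocGradedRing I) (assocGradedPlus I) s (AssocGradedModule I M) := by
  induction s generalizing M with
  | zero => exact iff_of_true (by intro i hi; lia) (by intro i hi; lia)
  | succ s ih =>
    have step {x : I} (hx : InitialRegular I M x) :=
      (lcVanish_LModule_succ_iff hx s).trans ((ih (QuotSMulTop (x : A) M)).trans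
        (lcVanish_assocGradedModule_succ_iff hx s).symm)
    constructor
    · intro h
      obtain ⟨x, hx⟩ := exists_initialRegular_of_lcVanish_LModule h
      exact (step hx).1 h
    · intro h
      obtain ⟨x, hx⟩ := exists_initialRegular_of_lcVanish_assocGradedModule h
      exact (step hx).2 h

/-- Elements of `I` whose initial forms are successively regular on `G_I(M)` are an `M`-regular
sequence. -/
theorem exists_isRegular_of_lcVanish (hI : I • (⊤ : Submodule A M) ≠ ⊤) {s : ℕ}
    (h : LcVanish (R := AssocGradedRing I) (assocGradedPlus I) s (AssocGradedModule I M)) :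
    ∃ rs : List A, rs.length = s ∧ (∀ r ∈ rs, r ∈ I) ∧ RingTheory.Sequence.IsRegular M rs := by
  induction s generalizing M with
  | zero =>
    have : Nontrivial M := (Submodule.nontrivial_iff A).mp (nontrivial_of_lt _ _ hI.lt_top)
    exact ⟨[], by simp [RingTheory.Sequence.isRegular_iff]⟩
  | succ s ih =>
    obtain ⟨x, hx⟩ := exists_initialRegular_of_lcVanish_assocGradedModule h
    obtain ⟨rs, hrs, hmem, hreg⟩ := ih (smul_top_quotSMulTop_ne_top x.2 hI)
      ((lcVanish_assocGradedModule_succ_iff hx s).1 h)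
    refine ⟨x :: rs, by simp [hrs], by simpa using hmem,
      (RingTheory.Sequence.isRegular_cons_iff _ _ _).2 ⟨hx.isSMulRegular ?_, hreg⟩⟩
    rintro rfl
    exact hI (by simp)

end Graded

end

end AsymptoticGrade

open AsymptoticGrade in
theorem corollary2p8 {A : Type u} [CommRing A] [IsNoetherianRing A] [IsLocalRing A]
    [Infinite (IsLocalRing.ResidueField A)]
    {M : Type u} [AddCommGroup M] [Module A M] [Module.Finite A M]
    (I : Ideal A) (g : ℕ) (hg : 0 < g) (hgrade : AsymptoticGrade.grade I M = g) :
    (∃ a : ℕ,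
      AsymptoticGrade.grade (R := AsymptoticGrade.AssocGradedRing I)
        (AsymptoticGrade.assocGradedPlus I)
        (AsymptoticGrade.AssocGradedModule I M) = a ∧
      IsLeast {i : ℕ | i ≤ g ∧ Nontrivial (AsymptoticGrade.lcL I M i)} a) ∧
    (∀ s : ℕ, s < g →
      ((∀ i ≤ s, Subsingleton (AsymptoticGrade.lcL I M i)) ↔
        (∀ i ≤ s, Subsingleton (AsymptoticGrade.lcG I M i)))) := by
  have hI : I • (⊤ : Submodule A M) ≠ ⊤ := smul_top_ne_top_of_grade_ne_top (by simp [hgrade])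
  have hLG := lcVanish_LModule_iff I M
  -- Here finiteness of the grade enters: the range of vanishing cannot exceed `g`.
  have hbound (s : ℕ) (hs : LcVanish (R := AssocGradedRing I) (assocGradedPlus I) s
      (AssocGradedModule I M)) : s ≤ g := by
    obtain ⟨rs, rfl, hmem, hrs⟩ := exists_isRegular_of_lcVanish hI hs
    exact_mod_cast hgrade ▸ le_grade hmem hrs
  classical
  have hzero : LcVanish (reesPlus I) 0 (LModule I M) := by intro i hi; lia
  let a := Nat.findGreatest (fun s => LcVanish (reesPlus I) s (LModule I M)) g
  have ha : LcVanish (reesPlus I) a (LModule I M) :=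
    Nat.findGreatest_spec (P := fun s => LcVanish (reesPlus I) s (LModule I M))
      (Nat.zero_le g) hzero
  have hmax (s : ℕ) (hs : LcVanish (reesPlus I) s (LModule I M)) : s ≤ a :=
    Nat.le_findGreatest (hbound s ((hLG s).1 hs)) hs
  refine ⟨⟨a, grade_assocGradedModule_eq hI ((hLG a).1 ha) fun s hs => hmax s ((hLG s).2 hs),
    ⟨hbound a ((hLG a).1 ha), ?_⟩, ?_⟩, fun s _ => ?_⟩
  · by_contra hsub
    rw [not_nontrivial_iff_subsingleton] at hsub
    have : a + 1 ≤ a := hmax _ fun i hi => by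
      rcases Nat.lt_succ_iff_lt_or_eq.1 hi with h | rfl
      · exact ha i h
      · exact hsub
    lia
  · rintro i ⟨-, hi⟩
    by_contra hlt
    exact not_nontrivial_iff_subsingleton.2 (ha i (not_le.1 hlt)) hi
  · simpa only [LcVanish, Nat.lt_succ_iff] using hLG (s + 1)
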